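/- For $s\in(0,1)$, an open set $\Omega\subset\mathbb R^n$ and a measurable set $E\subset\mathbb R^n$, let $$P_s^L(E,\Omega):=\int_{E\cap\Omega}\int_{\Omega\setminus E}\frac{dx\,dy}{|x-y|^{n+s}}\in[0,\infty]$$ be the local part of the $s$-fractional perimeter, let $\partial^-E:=\{x\in\mathbb R^n : 0<|E\cap B_r(x)|<|B_r(x)|\text{ for every }r>0\}$ be the measure theoretic boundary of $E$, and, when $\partial^-E\cap\Omega\neq\emptyset$, let $$\mathrm{Dim}_F(\partial^-E,\Omega):=n-\sup\{s\in(0,1) : P_s^L(E,\Omega)<\infty\}$$ be the fractal dimension of $\partial^-E$ in $\Omega$ (with $\sup\emptyset:=0$). Let $S\subset\mathbb R^2$ be the von Koch snowflake: start from a closed equilateral triangle $T$ of side $1$; at each step erect, over the middle third of every side of the current polygon and outside the polygon, a closed equilateral triangle, and replace that middle third by the other two sides of the new triangle; $S$ is the interior of the union of $T$ and all the triangles added in this way. Let $\Sigma$ be the limit, in the Hausdorff distance, of the boundary curves of the successive polygons. Then $\partial^-S=\partial S=\Sigma$, and $$\mathrm{Dim}_F(\partial S,\Omega)=\frac{\log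 4}{\log 3}$$ for every open set $\Omega\subset\mathbb R^2$ with $\partial S\cap\Omega\neq\emptyset$. In particular, $\mathrm{Dim}_F(\partial S,B_r(p))=\frac{\log4}{\log3}$ for every $p\in\partial S$ and every $r>0$. -/

import Mathlib

open MeasureTheory Set Filter Topology
open scoped ENNReal

namespace FractalDim

noncomputable section

/-- `𝓛_s(A, B) = ∫_A ∫_B |x - y|^{-(n+s)} dx dy`, with values in `[0, ∞]`
(used for disjoint `A` and `B`). -/
def interaction {n : ℕ} (s : ℝ) (A B : Set (EuclideanSpace ℝ (Fin n))) : ℝ≥0∞ :=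
  ∫⁻ x in A, ∫⁻ y in B, ENNReal.ofReal (1 / ‖x - y‖ ^ ((n : ℝ) + s))

/-- The local part `P_s^L(E, Ω) = 𝓛_s(E ∩ Ω, Eᶜ ∩ Ω)` of the `s`-fractional perimeter. -/
def localPerimeter {n : ℕ} (s : ℝ) (E Ω : Set (EuclideanSpace ℝ (Fin n))) : ℝ≥0∞ :=
  interaction s (E ∩ Ω) (Eᶜ ∩ Ω)

/-- The measure theoretic boundary `∂⁻E`: the points `x` with `0 < |E ∩ B_r(x)| < |B_r(x)|`
for every `r > 0`. -/
def essBoundary {n : ℕ} (E : Set (EuclideanSpace ℝ (Fin n))) : Set (EuclideanSpace ℝ (Fin n)) :=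
  {x | ∀ r : ℝ, 0 < r → 0 < volume (E ∩ Metric.ball x r) ∧
    volume (E ∩ Metric.ball x r) < volume (Metric.ball x r)}

/-- The fractal dimension `Dim_F(∂⁻E, Ω) = n - sup {s ∈ (0,1) | P_s^L(E, Ω) < ∞}`
(the supremum is taken in `[0,1]`, so it is `0` for the empty set). -/
def dimF {n : ℕ} (E Ω : Set (EuclideanSpace ℝ (Fin n))) : ℝ :=
  (n : ℝ) - sSup {s : ℝ | s ∈ Ioo (0 : ℝ) 1 ∧ localPerimeter s E Ω < ∞}

/-- The Euclidean plane. -/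
abbrev Plane := EuclideanSpace ℝ (Fin 2)

/-- Clockwise rotation of a vector by sixty degrees. -/
def rot (v : Plane) : Plane :=
  !₂[v 0 / 2 + √3 / 2 * v 1, -(√3 / 2) * v 0 + v 1 / 2]

/-- The first point of trisection of the oriented segment from `e.1` to `e.2`. -/
def third₁ (e : Plane × Plane) : Plane := e.1 + (1 / 3 : ℝ) • (e.2 - e.1)

/-- The second point of trisection. -/
def third₂ (e : Plane × Plane) : Plane := e.1 + (2 / 3 : ℝ) • (e.2 - e.1)

/-- The third vertex of the equilateral triangle which is erected over the middle third of the
oriented segment `e`, on its right-hand side. -/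
def apex (e : Plane × Plane) : Plane := third₁ e + rot ((1 / 3 : ℝ) • (e.2 - e.1))

/-- The closed equilateral triangle erected over the middle third of `e`. -/
def bump (e : Plane × Plane) : Set Plane := convexHull ℝ {third₁ e, apex e, third₂ e}

/-- One step of the von Koch construction: the middle third of a segment is replaced by the other
two sides of the equilateral triangle based on it. -/
def kochStep (e : Plane × Plane) : List (Plane × Plane) :=
  [(e.1, third₁ e), (third₁ e, apex e), (apex e, third₂ e), (third₂ e, e.2)]

/-- The vertices of the equilateral triangle with side `1`, barycentre at the origin and a vertex
on the positive second coordinate axis. -/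
def top : Plane := !₂[0, √3 / 3]

/-- The lower left vertex. -/
def left : Plane := !₂[-(1 / 2), -(√3 / 6)]

/-- The lower right vertex. -/
def right : Plane := !₂[1 / 2, -(√3 / 6)]

/-- The starting triangle (closed). -/
def triangle : Set Plane := convexHull ℝ {top, left, right}

/-- The oriented sides of the `k`-th polygon. The polygons run counterclockwise, so that the right
of each side is the outside. -/
def sides : ℕ → List (Plane × Plane)
  | 0 => [(top, left), (left, right), (right, top)]
  | k + 1 => (sides k).flatMap kochStep

/-- The `k`-th polygonal curve. -/
def polygon (k : ℕ) : Set Plane := ⋃ e ∈ sides k, segment ℝ e.1 e.2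

/-- The closed von Koch snowflake curve `Σ`: the limit of the polygonal curves. -/
def snowflakeCurve : Set Plane :=
  {x | Tendsto (fun k => Metric.infDist x (polygon k)) atTop (𝓝 0)}

/-- The von Koch snowflake: the open region which is filled by the starting triangle and all the
triangles that are added in the successive steps of the construction. -/
def snowflake : Set Plane :=
  interior (triangle ∪ ⋃ k : ℕ, ⋃ e ∈ sides k, bump e)

end

end FractalDim

/-!
The proof rests on an exact dissection of the plane. Over each side `e` of the `k`-th polygon lies
the isosceles triangle `cell e` with base `e` and apex `apex e`. In every step it is cut into the
added triangle `bump e`, two equilateral triangles `gaps e` which are never filled, and the cells of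
the four new sides. At level `k` the plane is thus the union of three closed sets: `inner k`
(filled), `outer k` (never filled) and `cells k` (undecided). The starting triangle with the three
initial cells forms a regular hexagon, whose outside belongs to `outer 0`. Pieces of different type
meet only along sides of cells or in vertices of the polygons (`isEnd_of_mem_cell`,
`cy_eq_zero_of_mem_inner`, `onRoof_of_mem_outer`, `exists_isEnd`). In the oblique coordinates
`cx e`, `cy e` of a side `e`, with axes enclosing an angle of sixty degrees, all vertices involved
are rational, so that every incidence statement is a matter of linear inequalities.

Consequently a point outside `cells k` has a neighbourhood that is filled or one that is never
filled, and the frontier of the snowflake lies in every `cells k`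
(`frontier_snowflake_subset_cells`), hence in the limit curve. Conversely, arbitrarily close to each
point of the limit curve there are cells, and each of them contains a disc inside the snowflake and
a disc outside, so the limit curve lies in the measure theoretic boundary.

For the dimension put `σ = 2 - log 4 / log 3`, so that `4 * 3 ^ (s - 2)` is less or greater than
`1` according to whether `s` is less or greater than `σ`.

If `0 < s < σ`, the perimeter is finite: a pair of points on different sides of the boundary at
distance about `3⁻ᵏ` has its first point in `collar k`, a union of `3 * 4 ^ k` discs of radius
`3 * 3⁻ᵏ`, and the contributions of the scales `k` are dominated by the geometric series with
ratio `4 * 3 ^ (s - 2)` (`localPerimeter_snowflake_lt_top`).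

If `s > σ`, the perimeter is infinite in every open set that meets the boundary: such a set contains
a cell, the local perimeter is superadditive over disjoint cells, and a cell of level `k`
contributes at least a constant times `3 ^ ((s - 2) * k)`, whereas the number of cells is multiplied by `4` in
each step (`localPerimeter_snowflake_eq_top`).
-/

namespace FractalDim

noncomputable section

/-! ### Oblique coordinates -/

/-- The point with oblique coordinates `(a, b)` in the frame `(e.2 - e.1, rot (e.2 - e.1))`
based at `e.1`. -/
def pt (e : Plane × Plane) (a b : ℝ) : Plane := e.1 + a • (e.2 - e.1) + b • rot (e.2 - e.1)

/-- The second oblique coordinate of `p` in the frame of the segment `e`; it is positive on the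
right-hand side of `e`. (The value is junk if `e` is degenerate.) -/
def cy (e : Plane × Plane) (p : Plane) : ℝ :=
  2 * √3 / 3 * ((e.2 1 - e.1 1) * (p 0 - e.1 0) - (e.2 0 - e.1 0) * (p 1 - e.1 1)) /
    ((e.2 0 - e.1 0) ^ 2 + (e.2 1 - e.1 1) ^ 2)

/-- The first oblique coordinate of `p` in the frame of the segment `e`. -/
def cx (e : Plane × Plane) (p : Plane) : ℝ :=
  ((e.2 0 - e.1 0) * (p 0 - e.1 0) + (e.2 1 - e.1 1) * (p 1 - e.1 1)) /
    ((e.2 0 - e.1 0) ^ 2 + (e.2 1 - e.1 1) ^ 2) - cy e p / 2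

theorem sqrt_three_sq : √3 ^ 2 = (3 : ℝ) := Real.sq_sqrt (by norm_num)

theorem sum_sq_pos {e : Plane × Plane} (h : e.1 ≠ e.2) :
    0 < (e.2 0 - e.1 0) ^ 2 + (e.2 1 - e.1 1) ^ 2 := by
  by_contra hn
  apply h
  have h0 : e.2 0 - e.1 0 = 0 := by nlinarith [sq_nonneg (e.2 0 - e.1 0), sq_nonneg (e.2 1 - e.1 1)]
  have h1 : e.2 1 - e.1 1 = 0 := by nlinarith [sq_nonneg (e.2 0 - e.1 0), sq_nonneg (e.2 1 - e.1 1)]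
  ext i
  fin_cases i
  · simp; linarith
  · simp; linarith

theorem pt_zero (e : Plane × Plane) (a b : ℝ) : pt e a b 0 =
    e.1 0 + a * (e.2 0 - e.1 0) +
      b * ((e.2 0 - e.1 0) / 2 + √3 / 2 * (e.2 1 - e.1 1)) := by
  simp [pt, rot]

theorem pt_one (e : Plane × Plane) (a b : ℝ) : pt e a b 1 =
    e.1 1 + a * (e.2 1 - e.1 1) +
      b * (-(√3 / 2) * (e.2 0 - e.1 0) + (e.2 1 - e.1 1) / 2) := by
  simp [pt, rot]

theorem plane_ext {p q : Plane} (h0 : p 0 = q 0) (h1 : p 1 = q 1) : p = q := by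
  ext i; fin_cases i
  · exact h0
  · exact h1

theorem cy_pt {e : Plane × Plane} (h : e.1 ≠ e.2) (a b : ℝ) : cy e (pt e a b) = b := by
  have := sum_sq_pos h
  rw [cy, pt_zero, pt_one, div_eq_iff this.ne']
  linear_combination (b * ((e.2 0 - e.1 0) ^ 2 + (e.2 1 - e.1 1) ^ 2) / 3) * sqrt_three_sq

theorem cx_pt {e : Plane × Plane} (h : e.1 ≠ e.2) (a b : ℝ) : cx e (pt e a b) = a := by
  have := sum_sq_pos h
  rw [cx, cy_pt h, pt_zero, pt_one, sub_eq_iff_eq_add, div_eq_iff this.ne']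
  ring

theorem pt_coords {e : Plane × Plane} (h : e.1 ≠ e.2) (p : Plane) :
    pt e (cx e p) (cy e p) = p := by
  have := sum_sq_pos h
  have h3 := sqrt_three_sq
  apply plane_ext
  · rw [pt_zero, cx, cy]
    field_simp
    linear_combination (p 0 - e.1 0) * (e.2 1 - e.1 1) ^ 2 * h3 -
      (p 1 - e.1 1) * (e.2 1 - e.1 1) * (e.2 0 - e.1 0) * h3
  · rw [pt_one, cx, cy]
    field_simp
    linear_combination (p 1 - e.1 1) * (e.2 0 - e.1 0) ^ 2 * h3 -
      (p 0 - e.1 0) * (e.2 1 - e.1 1) * (e.2 0 - e.1 0) * h3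

theorem coords_eq {e : Plane × Plane} (h : e.1 ≠ e.2) {p : Plane} {a b : ℝ}
    (hp : p = pt e a b) : cx e p = a ∧ cy e p = b := by
  rw [hp]; exact ⟨cx_pt h a b, cy_pt h a b⟩

theorem eq_pt_iff {e : Plane × Plane} (h : e.1 ≠ e.2) {p : Plane} {a b : ℝ} :
    p = pt e a b ↔ cx e p = a ∧ cy e p = b :=
  ⟨coords_eq h, fun ⟨h1, h2⟩ => by rw [← h1, ← h2, pt_coords h]⟩

theorem norm_sq_plane (v : Plane) : ‖v‖ ^ 2 = v 0 ^ 2 + v 1 ^ 2 := by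
  rw [EuclideanSpace.real_norm_sq_eq, Fin.sum_univ_two]

/-- The squared norm in the oblique frame, whose two vectors have equal length and enclose an
angle of sixty degrees. -/
theorem norm_sq_pt_sub_pt (e : Plane × Plane) (a b a' b' : ℝ) :
    ‖pt e a b - pt e a' b'‖ ^ 2 =
      ((a - a') ^ 2 + (a - a') * (b - b') + (b - b') ^ 2) * ‖e.2 - e.1‖ ^ 2 := by
  rw [norm_sq_plane, norm_sq_plane]
  simp only [PiLp.sub_apply, pt_zero, pt_one]
  linear_combination ((b - b') ^ 2 / 4 * ((e.2 0 - e.1 0) ^ 2 + (e.2 1 - e.1 1) ^ 2)) * sqrt_three_sq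

theorem dist_pt_le (e : Plane × Plane) {a b a' b' : ℝ} (ha : |a - a'| ≤ 1) (hb : |b - b'| ≤ 1) :
    dist (pt e a b) (pt e a' b') ≤ 2 * ‖e.2 - e.1‖ := by
  rw [dist_eq_norm]
  apply le_of_sq_le_sq _ (by positivity)
  rw [norm_sq_pt_sub_pt, mul_pow]
  apply mul_le_mul_of_nonneg_right _ (by positivity)
  rw [abs_le] at ha hb
  nlinarith [ha.1, ha.2, hb.1, hb.2]

theorem abs_cx_sub_le {e : Plane × Plane} (h : e.1 ≠ e.2) (p q : Plane) :
    |cx e p - cx e q| * ‖e.2 - e.1‖ ≤ 2 * ‖p - q‖ := by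
  apply le_of_sq_le_sq _ (by positivity)
  have := norm_sq_pt_sub_pt e (cx e p) (cy e p) (cx e q) (cy e q)
  rw [pt_coords h, pt_coords h] at this
  rw [mul_pow, mul_pow, this, sq_abs, ← mul_assoc]
  apply mul_le_mul_of_nonneg_right _ (by positivity)
  nlinarith [sq_nonneg (cx e p - cx e q + 2 * (cy e p - cy e q))]

theorem abs_cy_sub_le {e : Plane × Plane} (h : e.1 ≠ e.2) (p q : Plane) :
    |cy e p - cy e q| * ‖e.2 - e.1‖ ≤ 2 * ‖p - q‖ := by
  apply le_of_sq_le_sq _ (by positivity)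
  have := norm_sq_pt_sub_pt e (cx e p) (cy e p) (cx e q) (cy e q)
  rw [pt_coords h, pt_coords h] at this
  rw [mul_pow, mul_pow, this, sq_abs, ← mul_assoc]
  apply mul_le_mul_of_nonneg_right _ (by positivity)
  nlinarith [sq_nonneg (cy e p - cy e q + 2 * (cx e p - cx e q))]

@[fun_prop]
theorem continuous_cy (e : Plane × Plane) : Continuous (cy e) := by
  unfold cy; fun_prop

@[fun_prop]
theorem continuous_cx (e : Plane × Plane) : Continuous (cx e) := by
  unfold cx; fun_prop

theorem fst_eq_pt (e : Plane × Plane) : e.1 = pt e 0 0 := by simp [pt]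

theorem snd_eq_pt (e : Plane × Plane) : e.2 = pt e 1 0 := by simp [pt]

theorem third₁_eq_pt (e : Plane × Plane) : third₁ e = pt e (1 / 3) 0 := by simp [pt, third₁]

theorem third₂_eq_pt (e : Plane × Plane) : third₂ e = pt e (2 / 3) 0 := by simp [pt, third₂]

theorem apex_eq_pt (e : Plane × Plane) : apex e = pt e (1 / 3) (1 / 3) := by
  apply plane_ext
  · simp [apex, third₁, rot, pt]; ring
  · simp [apex, third₁, rot, pt]; ring

/-- Passing to the frame of a segment whose ends are given in the frame of `e`; multiplication by
`rot` obeys `rot ^ 2 = rot - 1`. -/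
theorem pt_pt (e : Plane × Plane) (a₁ b₁ a₂ b₂ a b : ℝ) :
    pt (pt e a₁ b₁, pt e a₂ b₂) a b =
      pt e (a₁ + a * (a₂ - a₁) - b * (b₂ - b₁))
        (b₁ + a * (b₂ - b₁) + b * (a₂ - a₁) + b * (b₂ - b₁)) := by
  apply plane_ext
  · simp only [pt_zero, pt_one]
    linear_combination (-b * (b₂ - b₁) / 4 * (e.2 0 - e.1 0)) * sqrt_three_sq
  · simp only [pt_zero, pt_one]
    linear_combination (-b * (b₂ - b₁) / 4 * (e.2 1 - e.1 1)) * sqrt_three_sq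

theorem coords_combination {e : Plane × Plane} (h : e.1 ≠ e.2) (p q : Plane) {x y : ℝ}
    (hxy : x + y = 1) :
    cx e (x • p + y • q) = x * cx e p + y * cx e q ∧
      cy e (x • p + y • q) = x * cy e p + y * cy e q := by
  apply coords_eq h
  nth_rw 1 [← pt_coords h p, ← pt_coords h q]
  obtain rfl : x = 1 - y := by linarith
  unfold pt
  module

/-- The triangle spanned by three points, in oblique coordinates. -/
theorem mem_convexHull_pt {e : Plane × Plane} (h : e.1 ≠ e.2) {a₁ b₁ a₂ b₂ a₃ b₃ : ℝ}
    {p : Plane} :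
    p ∈ convexHull ℝ {pt e a₁ b₁, pt e a₂ b₂, pt e a₃ b₃} ↔
      ∃ x y z : ℝ, 0 ≤ x ∧ 0 ≤ y ∧ 0 ≤ z ∧ x + y + z = 1 ∧
        cx e p = x * a₁ + y * a₂ + z * a₃ ∧ cy e p = x * b₁ + y * b₂ + z * b₃ := by
  constructor
  · intro hp
    let s : Set Plane := {p | ∃ x y z : ℝ, 0 ≤ x ∧ 0 ≤ y ∧ 0 ≤ z ∧ x + y + z = 1 ∧
        cx e p = x * a₁ + y * a₂ + z * a₃ ∧ cy e p = x * b₁ + y * b₂ + z * b₃}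
    have hs : Convex ℝ s := by
      rintro p ⟨x, y, z, hx, hy, hz, hs, h1, h2⟩ q ⟨x', y', z', hx', hy', hz', hs', h1', h2'⟩
        u v hu hv huv
      obtain ⟨hX, hY⟩ := coords_combination h p q huv
      refine ⟨u * x + v * x', u * y + v * y', u * z + v * z', by positivity, by positivity,
        by positivity, by linear_combination u * hs + v * hs' + huv, ?_, ?_⟩
      · rw [hX, h1, h1']; ring
      · rw [hY, h2, h2']; ring
    refine convexHull_min ?_ hs hp
    rintro q (rfl | rfl | rfl)
    · exact ⟨1, 0, 0, by simp [cx_pt h, cy_pt h]⟩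
    · exact ⟨0, 1, 0, by simp [cx_pt h, cy_pt h]⟩
    · exact ⟨0, 0, 1, by simp [cx_pt h, cy_pt h]⟩
  · rintro ⟨x, y, z, hx, hy, hz, hs, h1, h2⟩
    have hp : p = x • pt e a₁ b₁ + y • pt e a₂ b₂ + z • pt e a₃ b₃ := by
      rw [(eq_pt_iff h).2 ⟨h1, h2⟩]
      obtain rfl : x = 1 - y - z := by linarith
      unfold pt
      module
    have := (convex_convexHull ℝ {pt e a₁ b₁, pt e a₂ b₂, pt e a₃ b₃}).sum_mem
      (t := Finset.univ) (w := ![x, y, z]) (z := ![pt e a₁ b₁, pt e a₂ b₂, pt e a₃ b₃])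
      (by intro i _; fin_cases i <;> simpa) (by simp [Fin.sum_univ_three, hs])
      (by intro i _; apply subset_convexHull; fin_cases i <;> simp)
    rw [hp]
    simpa [Fin.sum_univ_three] using this

theorem mem_bump {e : Plane × Plane} (h : e.1 ≠ e.2) {p : Plane} :
    p ∈ bump e ↔ 1 / 3 ≤ cx e p ∧ 0 ≤ cy e p ∧ cx e p + cy e p ≤ 2 / 3 := by
  rw [bump, third₁_eq_pt, apex_eq_pt, third₂_eq_pt, mem_convexHull_pt h]
  constructor
  · rintro ⟨x, y, z, hx, hy, hz, hs, h1, h2⟩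
    refine ⟨?_, ?_, ?_⟩ <;> linarith
  · rintro ⟨h1, h2, h3⟩
    exact ⟨2 - 3 * cx e p - 3 * cy e p, 3 * cy e p, 3 * cx e p - 1, by linarith, by linarith,
      by linarith, by ring, by ring, by ring⟩

/-- The four segments that replace `e` in one step. -/
def kid (e : Plane × Plane) : Fin 4 → Plane × Plane :=
  ![(pt e 0 0, pt e (1 / 3) 0), (pt e (1 / 3) 0, pt e (1 / 3) (1 / 3)),
    (pt e (1 / 3) (1 / 3), pt e (2 / 3) 0), (pt e (2 / 3) 0, pt e 1 0)]

theorem mem_kochStep {e c : Plane × Plane} : c ∈ kochStep e ↔ ∃ i, c = kid e i := by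
  simp only [kochStep, third₁_eq_pt, apex_eq_pt, third₂_eq_pt, Fin.exists_fin_succ, kid]
  nth_rw 1 [fst_eq_pt e, snd_eq_pt e]
  simp

theorem norm_kid (e : Plane × Plane) (i : Fin 4) :
    ‖(kid e i).2 - (kid e i).1‖ = ‖e.2 - e.1‖ / 3 := by
  rw [← sq_eq_sq₀ (by positivity) (by positivity), div_pow]
  fin_cases i <;> simp only [kid, Matrix.cons_val, Fin.reduceFinMk, Fin.zero_eta, Fin.mk_one] <;>
    rw [norm_sq_pt_sub_pt] <;> ring

theorem kid_ne {e : Plane × Plane} (h : e.1 ≠ e.2) (i : Fin 4) : (kid e i).1 ≠ (kid e i).2 := by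
  intro hn
  have := norm_kid e i
  rw [hn, sub_self, norm_zero] at this
  have : ‖e.2 - e.1‖ = 0 := by linarith
  exact h (by rw [norm_eq_zero, sub_eq_zero] at this; exact this.symm)

/-- The coordinates with respect to the four new segments in terms of those with respect to `e`. -/
theorem coords_kid {e : Plane × Plane} (h : e.1 ≠ e.2) (p : Plane) :
    (cx (kid e 0) p = 3 * cx e p ∧ cy (kid e 0) p = 3 * cy e p) ∧
    (cx (kid e 1) p = 3 * cx e p + 3 * cy e p - 1 ∧ cy (kid e 1) p = 1 - 3 * cx e p) ∧
    (cx (kid e 2) p = 1 - 3 * cy e p ∧ cy (kid e 2) p = 3 * cx e p + 3 * cy e p - 2) ∧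
    (cx (kid e 3) p = 3 * cx e p - 2 ∧ cy (kid e 3) p = 3 * cy e p) := by
  refine ⟨coords_eq (kid_ne h 0) ?_, coords_eq (kid_ne h 1) ?_, coords_eq (kid_ne h 2) ?_,
    coords_eq (kid_ne h 3) ?_⟩ <;>
  · simp only [kid, Matrix.cons_val]
    rw [pt_pt, eq_pt_iff h]
    constructor <;> ring

/-! ### The dissection of a single cell -/

/-- The closed triangle with vertices `e.1`, `e.2`, `apex e`, which contains everything that the
construction ever adds over `e`. -/
def cell (e : Plane × Plane) : Set Plane :=
  {p | 0 ≤ cy e p ∧ cy e p ≤ cx e p ∧ cx e p + 2 * cy e p ≤ 1}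

/-- The two closed equilateral triangles which complete the bump over `e` and the cells of the four
segments replacing `e` to a dissection of `cell e`. -/
def gaps (e : Plane × Plane) : Set Plane :=
  {p | (cy e p ≤ cx e p ∧ 1 / 3 ≤ cx e p + 2 * cy e p ∧ 2 * cx e p + cy e p ≤ 2 / 3) ∨
    (cx e p + 2 * cy e p ≤ 1 ∧ cx e p - cy e p ≤ 2 / 3 ∧ 4 / 3 ≤ 2 * cx e p + cy e p)}

/-- The interior of the first of the two triangles in `gaps e`. -/
def openGap (e : Plane × Plane) : Set Plane :=
  {p | cy e p < cx e p ∧ 1 / 3 < cx e p + 2 * cy e p ∧ 2 * cx e p + cy e p < 2 / 3}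

/-- The point `p` is an end of the segment `e`. -/
def IsEnd (e : Plane × Plane) (p : Plane) : Prop := cy e p = 0 ∧ (cx e p = 0 ∨ cx e p = 1)

theorem cell_subset_union {e : Plane × Plane} (h : e.1 ≠ e.2) :
    cell e ⊆ bump e ∪ gaps e ∪ ⋃ i, cell (kid e i) := by
  intro p hp
  have h4 := coords_kid h p
  simp only [mem_union, mem_iUnion, Fin.exists_fin_succ, mem_bump h, cell, gaps,
    mem_ofPred_eq] at hp ⊢
  simp only [Fin.succ_zero_eq_one, Fin.succ_one_eq_two, Fin.reduceSucc, h4,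
    IsEmpty.exists_iff]
  grind

theorem bump_subset_cell {e : Plane × Plane} (h : e.1 ≠ e.2) : bump e ⊆ cell e := by
  intro p hp
  rw [mem_bump h] at hp
  simp only [cell, mem_ofPred_eq]
  grind

theorem gaps_subset_cell (e : Plane × Plane) : gaps e ⊆ cell e := by
  intro p hp
  simp only [gaps, cell, mem_ofPred_eq] at hp ⊢
  grind

theorem openGap_subset_gaps (e : Plane × Plane) : openGap e ⊆ gaps e :=
  fun _ hp => Or.inl ⟨hp.1.le, hp.2.1.le, hp.2.2.le⟩

theorem cell_kid_subset {e : Plane × Plane} (h : e.1 ≠ e.2) (i : Fin 4) :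
    cell (kid e i) ⊆ cell e := by
  intro p hp
  have h4 := coords_kid h p
  simp only [cell, mem_ofPred_eq] at hp ⊢
  fin_cases i <;> simp only [Fin.reduceFinMk, Fin.zero_eta, Fin.mk_one, h4] at hp <;> grind

/-- The bump over `e` and the base of `cell e` meet the cell of a segment replacing `e` only in the
base of that cell. -/
theorem cy_kid_eq_zero {e : Plane × Plane} (h : e.1 ≠ e.2) {i : Fin 4} {p : Plane}
    (hp : p ∈ cell (kid e i)) (hb : p ∈ bump e ∨ cy e p = 0) : cy (kid e i) p = 0 := by
  have h4 := coords_kid h p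
  rw [mem_bump h] at hb
  simp only [cell, mem_ofPred_eq] at hp
  fin_cases i <;> simp only [Fin.reduceFinMk, Fin.zero_eta, Fin.mk_one, h4] at hp ⊢ <;> grind

/-- The point `p` lies on one of the lines through the two upper sides of `cell e`. -/
def OnRoof (e : Plane × Plane) (p : Plane) : Prop := cy e p = cx e p ∨ cx e p + 2 * cy e p = 1

/-- The gaps of `e` and the upper sides of `cell e` meet the cell of a segment replacing `e` only in
the upper sides of that cell. -/
theorem onRoof_kid {e : Plane × Plane} (h : e.1 ≠ e.2) {i : Fin 4} {p : Plane}
    (hp : p ∈ cell (kid e i)) (hb : p ∈ gaps e ∨ OnRoof e p) : OnRoof (kid e i) p := by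
  have h4 := coords_kid h p
  simp only [cell, gaps, OnRoof, mem_ofPred_eq] at hp hb ⊢
  fin_cases i <;> simp only [Fin.reduceFinMk, Fin.zero_eta, Fin.mk_one, h4] at hp ⊢ <;> grind

theorem IsEnd.cy_eq_zero {e : Plane × Plane} {p : Plane} (h : IsEnd e p) : cy e p = 0 := h.1

theorem IsEnd.onRoof {e : Plane × Plane} {p : Plane} (h : IsEnd e p) : OnRoof e p := by
  simp only [IsEnd, OnRoof] at *; grind

theorem IsEnd.mem_cell {e : Plane × Plane} {p : Plane} (h : IsEnd e p) : p ∈ cell e := by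
  simp only [IsEnd, cell, mem_ofPred_eq] at *; grind

theorem IsEnd.notMem_openGap {e : Plane × Plane} {p : Plane} (h : IsEnd e p) : p ∉ openGap e := by
  simp only [IsEnd, openGap, mem_ofPred_eq] at *; grind

theorem IsEnd.kid {e : Plane × Plane} (h : e.1 ≠ e.2) {i : Fin 4} {p : Plane} (hp : IsEnd e p)
    (hc : p ∈ cell (kid e i)) : IsEnd (kid e i) p := by
  have h4 := coords_kid h p
  simp only [cell, IsEnd, mem_ofPred_eq] at *
  fin_cases i <;> simp only [Fin.reduceFinMk, Fin.zero_eta, Fin.mk_one, h4] at hc ⊢ <;> grind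

theorem IsEnd.exists_kid {e : Plane × Plane} (h : e.1 ≠ e.2) {p : Plane} (hp : IsEnd e p) :
    ∃ i, IsEnd (FractalDim.kid e i) p := by
  have h4 := coords_kid h p
  simp only [IsEnd] at *
  simp only [Fin.exists_fin_succ, Fin.succ_zero_eq_one, Fin.succ_one_eq_two, Fin.reduceSucc, h4,
    IsEmpty.exists_iff]
  grind

theorem isEnd_of_mem_cell_kid {e : Plane × Plane} (h : e.1 ≠ e.2) {i j : Fin 4} {p : Plane}
    (hi : p ∈ cell (kid e i)) (hj : p ∈ cell (kid e j)) (hij : i ≠ j) : IsEnd (kid e i) p := by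
  have h4 := coords_kid h p
  simp only [cell, IsEnd, mem_ofPred_eq] at *
  fin_cases i <;> fin_cases j <;>
    simp only [Fin.reduceFinMk, Fin.zero_eta, Fin.mk_one, h4] at hi hj hij ⊢ <;> grind

theorem notMem_openGap_of_mem_cell_kid {e : Plane × Plane} (h : e.1 ≠ e.2) {i : Fin 4} {p : Plane}
    (hi : p ∈ cell (kid e i)) : p ∉ openGap e := by
  have h4 := coords_kid h p
  simp only [cell, openGap, mem_ofPred_eq] at *
  fin_cases i <;> simp only [Fin.reduceFinMk, Fin.zero_eta, Fin.mk_one, h4] at hi ⊢ <;> grind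

/-- The bump over `e` meets the gaps and the roof of `cell e`, and the gaps meet the base, only in
ends of the segments replacing `e`. -/
theorem exists_isEnd_kid {e : Plane × Plane} (h : e.1 ≠ e.2) {p : Plane}
    (hp : p ∈ bump e ∧ (p ∈ gaps e ∨ OnRoof e p) ∨ p ∈ gaps e ∧ cy e p = 0) :
    ∃ i, IsEnd (kid e i) p := by
  obtain ⟨⟨h0, h0'⟩, ⟨h1, h1'⟩, -, ⟨h3, h3'⟩⟩ := coords_kid h p
  rw [mem_bump h] at hp
  simp only [gaps, OnRoof, mem_ofPred_eq] at hp
  -- the three vertices of the bump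
  have key : cx e p = 1 / 3 ∧ cy e p = 0 ∨ cx e p = 1 / 3 ∧ cy e p = 1 / 3 ∨
      cx e p = 2 / 3 ∧ cy e p = 0 := by
    rcases hp with ⟨⟨ha, hb, hc⟩, (hd | hd) | (hd | hd)⟩ | ⟨hd | hd, hy⟩ <;> grind
  rcases key with hk | hk | hk
  · exact ⟨0, by rw [h0', hk.2]; norm_num, .inr (by rw [h0, hk.1]; norm_num)⟩
  · exact ⟨1, by rw [h1', hk.1]; norm_num, .inr (by rw [h1, hk.1, hk.2]; norm_num)⟩
  · exact ⟨3, by rw [h3', hk.2]; norm_num, .inl (by rw [h3, hk.1]; norm_num)⟩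

/-! ### The dissection of the plane -/

/-- The lower side of the starting triangle, whose frame serves as a global coordinate system. -/
def bottom : Plane × Plane := (left, right)

theorem norm_bottom : ‖bottom.2 - bottom.1‖ = 1 := by
  rw [← sq_eq_sq₀ (norm_nonneg _) zero_le_one, norm_sq_plane]
  simp [bottom, left, right]; norm_num

theorem bottom_ne : bottom.1 ≠ bottom.2 := by
  intro h
  have := norm_bottom
  simp [h] at this

theorem top_eq_pt : top = pt bottom 1 (-1) := by
  apply plane_ext
  · simp [pt, rot, top, left, right, bottom]
  · simp [pt, rot, top, left, right, bottom]; ring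

theorem left_eq_pt : left = pt bottom 0 0 := fst_eq_pt bottom

theorem right_eq_pt : right = pt bottom 1 0 := snd_eq_pt bottom

theorem mem_triangle {p : Plane} :
    p ∈ triangle ↔ cy bottom p ≤ 0 ∧ cx bottom p ≤ 1 ∧ 0 ≤ cx bottom p + cy bottom p := by
  rw [triangle, top_eq_pt, left_eq_pt, right_eq_pt, mem_convexHull_pt bottom_ne]
  constructor
  · rintro ⟨x, y, z, hx, hy, hz, hs, h1, h2⟩
    refine ⟨?_, ?_, ?_⟩ <;> linarith
  · rintro ⟨h1, h2, h3⟩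
    exact ⟨-cy bottom p, 1 - cx bottom p, cx bottom p + cy bottom p, by linarith, by linarith,
      by linarith, by ring, by ring, by ring⟩

theorem mem_sides_zero {e : Plane × Plane} :
    e ∈ sides 0 ↔ e = (top, left) ∨ e = bottom ∨ e = (right, top) := by
  simp [sides, bottom]

theorem norm_of_mem_sides_zero {e : Plane × Plane} (he : e ∈ sides 0) : ‖e.2 - e.1‖ = 1 := by
  have h1 := norm_bottom
  rw [← sq_eq_sq₀ (norm_nonneg _) zero_le_one]
  rw [mem_sides_zero] at he
  rcases he with rfl | rfl | rfl
  · simp only [top_eq_pt, left_eq_pt]; rw [norm_sq_pt_sub_pt, h1]; norm_num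
  · rw [h1]
  · simp only [top_eq_pt, right_eq_pt]; rw [norm_sq_pt_sub_pt, h1]; norm_num

theorem mem_sides_succ {k : ℕ} {c : Plane × Plane} :
    c ∈ sides (k + 1) ↔ ∃ e ∈ sides k, ∃ i, c = kid e i := by
  simp [sides, List.mem_flatMap, mem_kochStep]

theorem norm_of_mem_sides {k : ℕ} : ∀ {e : Plane × Plane}, e ∈ sides k →
    ‖e.2 - e.1‖ = (1 / 3) ^ k := by
  induction k with
  | zero => intro e he; simpa using norm_of_mem_sides_zero he
  | succ k ih =>
    intro c hc
    obtain ⟨e, he, i, rfl⟩ := mem_sides_succ.1 hc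
    rw [norm_kid, ih he]; ring

theorem ne_of_mem_sides {k : ℕ} {e : Plane × Plane} (he : e ∈ sides k) : e.1 ≠ e.2 := by
  intro h
  have := norm_of_mem_sides he
  rw [h, sub_self, norm_zero] at this
  exact absurd this (by positivity)

theorem length_sides (k : ℕ) : (sides k).length = 3 * 4 ^ k := by
  induction k with
  | zero => rfl
  | succ k ih =>
    have : ∀ l : List (Plane × Plane), (l.flatMap kochStep).length = l.length * 4 := by
      intro l
      induction l with
      | nil => rfl
      | cons a l ih => rw [List.flatMap_cons, List.length_append, ih]; simp [kochStep]; ring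
    rw [sides, this, ih]; ring

theorem coords_top_left (p : Plane) :
    cx (top, left) p = cy bottom p + 1 ∧ cy (top, left) p = -cx bottom p - cy bottom p := by
  apply coords_eq (ne_of_mem_sides (k := 0) (by simp [sides]))
  rw [top_eq_pt, left_eq_pt, pt_pt, eq_pt_iff bottom_ne]
  constructor <;> ring

theorem coords_right_top (p : Plane) :
    cx (right, top) p = 1 - cx bottom p - cy bottom p ∧ cy (right, top) p = cx bottom p - 1 := by
  apply coords_eq (ne_of_mem_sides (k := 0) (by simp [sides]))
  rw [top_eq_pt, right_eq_pt, pt_pt, eq_pt_iff bottom_ne]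
  constructor <;> ring

/-- The closed region enclosed by the `k`-th polygon. -/
def inner : ℕ → Set Plane
  | 0 => triangle
  | k + 1 => inner k ∪ ⋃ e ∈ sides k, bump e

/-- The closed region which lies outside the snowflake for reasons visible in the first `k` steps:
the outside of the hexagon formed by the starting triangle and the three cells on its sides,
together with the gaps of the first `k` steps. -/
def outer : ℕ → Set Plane
  | 0 => ⋃ e ∈ sides 0, {p | cx e p ≤ cy e p ∨ 1 ≤ cx e p + 2 * cy e p}
  | k + 1 => outer k ∪ ⋃ e ∈ sides k, gaps e

/-- The union of the cells of the `k`-th sides. -/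
def cells (k : ℕ) : Set Plane := ⋃ e ∈ sides k, cell e

theorem mem_cells {k : ℕ} {p : Plane} : p ∈ cells k ↔ ∃ e ∈ sides k, p ∈ cell e := by
  simp [cells]

theorem mem_inner_succ {k : ℕ} {p : Plane} :
    p ∈ inner (k + 1) ↔ p ∈ inner k ∨ ∃ e ∈ sides k, p ∈ bump e := by
  simp [inner]

theorem mem_outer_succ {k : ℕ} {p : Plane} :
    p ∈ outer (k + 1) ↔ p ∈ outer k ∨ ∃ e ∈ sides k, p ∈ gaps e := by
  simp [outer]

theorem inner_union_cells_union_outer (k : ℕ) (p : Plane) :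
    p ∈ inner k ∨ p ∈ cells k ∨ p ∈ outer k := by
  induction k with
  | zero =>
    have h1 := coords_top_left p
    have h2 := coords_right_top p
    simp only [inner, mem_triangle, mem_cells, outer, mem_sides_zero, cell, mem_iUnion,
      exists_eq_or_imp, exists_eq_left, mem_ofPred_eq, exists_prop, h1, h2]
    grind
  | succ k ih =>
    rw [mem_inner_succ, mem_outer_succ, mem_cells]
    rcases ih with h | h | h
    · exact .inl (.inl h)
    · obtain ⟨e, he, hp⟩ := mem_cells.1 h
      rcases cell_subset_union (ne_of_mem_sides he) hp with (h | h) | h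
      · exact .inl (.inr ⟨e, he, h⟩)
      · exact .inr (.inr (.inr ⟨e, he, h⟩))
      · obtain ⟨i, hi⟩ := mem_iUnion.1 h
        exact .inr (.inl ⟨_, mem_sides_succ.2 ⟨e, he, i, rfl⟩, hi⟩)
    · exact .inr (.inr (.inl h))

/-- Different cells of one generation have at most the ends of their bases in common. -/
theorem isEnd_of_mem_cell {k : ℕ} : ∀ {e e' : Plane × Plane}, e ∈ sides k → e' ∈ sides k →
    e ≠ e' → ∀ {p : Plane}, p ∈ cell e → p ∈ cell e' → IsEnd e p := by
  induction k with
  | zero =>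
    intro e e' he he' hne p hp hp'
    have h1 := coords_top_left p
    have h2 := coords_right_top p
    rw [mem_sides_zero] at he he'
    rcases he with rfl | rfl | rfl <;> rcases he' with rfl | rfl | rfl <;>
      first
      | exact absurd rfl hne
      | (simp only [cell, IsEnd, mem_ofPred_eq, h1, h2] at hp hp' ⊢; grind)
  | succ k ih =>
    intro c c' hc hc' hne p hp hp'
    obtain ⟨e, he, i, rfl⟩ := mem_sides_succ.1 hc
    obtain ⟨e', he', j, rfl⟩ := mem_sides_succ.1 hc'
    have h := ne_of_mem_sides he
    by_cases hee : e = e'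
    · subst hee
      exact isEnd_of_mem_cell_kid h hp hp' fun hij => hne (by rw [hij])
    · exact (ih he he' hee (cell_kid_subset h i hp)
        (cell_kid_subset (ne_of_mem_sides he') j hp')).kid h hp

/-- The region filled in the first `k` steps meets the cells of the `k`-th sides only in their
bases. -/
theorem cy_eq_zero_of_mem_inner {k : ℕ} : ∀ {e : Plane × Plane}, e ∈ sides k →
    ∀ {p : Plane}, p ∈ cell e → p ∈ inner k → cy e p = 0 := by
  induction k with
  | zero =>
    intro e he p hp hi
    have h1 := coords_top_left p
    have h2 := coords_right_top p
    rw [mem_sides_zero] at he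
    simp only [inner, mem_triangle] at hi
    rcases he with rfl | rfl | rfl <;> simp only [cell, mem_ofPred_eq, h1, h2] at hp ⊢ <;> grind
  | succ k ih =>
    intro c hc p hp hi
    obtain ⟨e, he, i, rfl⟩ := mem_sides_succ.1 hc
    have h := ne_of_mem_sides he
    have hpe := cell_kid_subset h i hp
    apply cy_kid_eq_zero h hp
    rcases mem_inner_succ.1 hi with hi | ⟨e', he', hb⟩
    · exact .inr (ih he hpe hi)
    · by_cases hee : e = e'
      · exact .inl (hee ▸ hb)
      · exact .inr (isEnd_of_mem_cell he he' hee hpe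
          (bump_subset_cell (ne_of_mem_sides he') hb)).cy_eq_zero

/-- The `k`-th outer region meets the cells of the `k`-th sides only in their two upper sides. -/
theorem onRoof_of_mem_outer {k : ℕ} : ∀ {e : Plane × Plane}, e ∈ sides k →
    ∀ {p : Plane}, p ∈ cell e → p ∈ outer k → OnRoof e p := by
  induction k with
  | zero =>
    intro e he p hp hi
    have h1 := coords_top_left p
    have h2 := coords_right_top p
    rw [mem_sides_zero] at he
    simp only [outer, mem_sides_zero, mem_iUnion,
      exists_eq_or_imp, exists_eq_left, mem_ofPred_eq, exists_prop, h1, h2] at hi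
    rcases he with rfl | rfl | rfl <;> simp only [cell, OnRoof, mem_ofPred_eq, h1, h2] at hp ⊢ <;>
      grind
  | succ k ih =>
    intro c hc p hp hi
    obtain ⟨e, he, i, rfl⟩ := mem_sides_succ.1 hc
    have h := ne_of_mem_sides he
    have hpe := cell_kid_subset h i hp
    apply onRoof_kid h hp
    rcases mem_outer_succ.1 hi with hi | ⟨e', he', hb⟩
    · exact .inr (ih he hpe hi)
    · by_cases hee : e = e'
      · exact .inl (hee ▸ hb)
      · exact .inr (isEnd_of_mem_cell he he' hee hpe (gaps_subset_cell e' hb)).onRoof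

/-- The `k`-th inner and outer regions have only vertices of the `k`-th polygon in common. -/
theorem exists_isEnd {k : ℕ} : ∀ {p : Plane}, p ∈ inner k → p ∈ outer k →
    ∃ e ∈ sides k, IsEnd e p := by
  induction k with
  | zero =>
    intro p hi ho
    have h1 := coords_top_left p
    have h2 := coords_right_top p
    simp only [outer, mem_sides_zero, mem_iUnion,
      exists_eq_or_imp, exists_eq_left, mem_ofPred_eq, exists_prop, h1, h2] at ho
    simp only [inner, mem_triangle] at hi
    simp only [mem_sides_zero, exists_eq_or_imp, exists_eq_left, IsEnd, h1, h2]
    grind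
  | succ k ih =>
    intro p hi ho
    suffices ∃ e ∈ sides k, ∃ i, IsEnd (kid e i) p by
      obtain ⟨e, he, i, h⟩ := this
      exact ⟨_, mem_sides_succ.2 ⟨e, he, i, rfl⟩, h⟩
    rcases mem_inner_succ.1 hi with hi | ⟨e, he, hb⟩
    · rcases mem_outer_succ.1 ho with ho | ⟨e, he, hg⟩
      · obtain ⟨e, he, h⟩ := ih hi ho
        exact ⟨e, he, h.exists_kid (ne_of_mem_sides he)⟩
      · exact ⟨e, he, exists_isEnd_kid (ne_of_mem_sides he)
          (.inr ⟨hg, cy_eq_zero_of_mem_inner he (gaps_subset_cell e hg) hi⟩)⟩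
    · have h := ne_of_mem_sides he
      have hbc := bump_subset_cell h hb
      rcases mem_outer_succ.1 ho with ho | ⟨e', he', hg⟩
      · exact ⟨e, he, exists_isEnd_kid h (.inl ⟨hb, .inr (onRoof_of_mem_outer he hbc ho)⟩)⟩
      · by_cases hee : e = e'
        · exact ⟨e, he, exists_isEnd_kid h (.inl ⟨hb, .inl (hee ▸ hg)⟩)⟩
        · exact ⟨e, he, (isEnd_of_mem_cell he he' hee hbc
            (gaps_subset_cell e' hg)).exists_kid h⟩

theorem mem_cells_of_mem_inner_of_mem_outer {k : ℕ} {p : Plane} (hi : p ∈ inner k)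
    (ho : p ∈ outer k) : p ∈ cells k := by
  obtain ⟨e, he, h⟩ := exists_isEnd hi ho
  exact mem_cells.2 ⟨e, he, h.mem_cell⟩

theorem cells_antitone : Antitone cells := by
  refine antitone_nat_of_succ_le fun k p hp => ?_
  obtain ⟨c, hc, h⟩ := mem_cells.1 hp
  obtain ⟨e, he, i, rfl⟩ := mem_sides_succ.1 hc
  exact mem_cells.2 ⟨e, he, cell_kid_subset (ne_of_mem_sides he) i h⟩

theorem inner_monotone : Monotone inner :=
  monotone_nat_of_le_succ fun _ _ hp => mem_inner_succ.2 (.inl hp)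

/-- The union of all the triangles of the construction, whose interior is the snowflake. -/
def closedFlake : Set Plane := triangle ∪ ⋃ k : ℕ, ⋃ e ∈ sides k, bump e

theorem snowflake_eq : snowflake = interior closedFlake := rfl

theorem mem_closedFlake {p : Plane} : p ∈ closedFlake ↔ ∃ k, p ∈ inner k := by
  constructor
  · rintro (h | h)
    · exact ⟨0, h⟩
    · simp only [mem_iUnion] at h
      obtain ⟨k, e, he, h⟩ := h
      exact ⟨k + 1, mem_inner_succ.2 (.inr ⟨e, he, h⟩)⟩
  · rintro ⟨k, h⟩
    induction k with
    | zero => exact .inl h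
    | succ k ih =>
      rcases mem_inner_succ.1 h with h | ⟨e, he, h⟩
      · exact ih h
      · exact .inr (by simp only [mem_iUnion]; exact ⟨k, e, he, h⟩)

theorem bump_subset_closedFlake {k : ℕ} {e : Plane × Plane} (he : e ∈ sides k) :
    bump e ⊆ closedFlake :=
  fun _ hp => mem_closedFlake.2 ⟨k + 1, mem_inner_succ.2 (.inr ⟨e, he, hp⟩)⟩

/-- Later triangles stay within the present cells. -/
theorem closedFlake_subset (k : ℕ) : closedFlake ⊆ inner k ∪ cells k := by
  intro p hp
  obtain ⟨j, hj⟩ := mem_closedFlake.1 hp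
  rcases le_total j k with hjk | hkj
  · exact .inl (inner_monotone hjk hj)
  · induction j, hkj using Nat.le_induction with
    | base => exact .inl hj
    | succ j hkj ih =>
      rcases mem_inner_succ.1 hj with h | ⟨e, he, h⟩
      · exact ih h
      · exact .inr (cells_antitone hkj
          (mem_cells.2 ⟨e, he, bump_subset_cell (ne_of_mem_sides he) h⟩))

theorem disjoint_openGap_closedFlake {k : ℕ} {e : Plane × Plane} (he : e ∈ sides k) :
    Disjoint (openGap e) closedFlake := by
  rw [Set.disjoint_left]
  intro p hp hW
  have hg := openGap_subset_gaps e hp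
  have hc : p ∈ cells (k + 1) := by
    rcases closedFlake_subset (k + 1) hW with h | h
    · exact mem_cells_of_mem_inner_of_mem_outer h (mem_outer_succ.2 (.inr ⟨e, he, hg⟩))
    · exact h
  obtain ⟨c, hc, hpc⟩ := mem_cells.1 hc
  obtain ⟨e', he', i, rfl⟩ := mem_sides_succ.1 hc
  by_cases hee : e = e'
  · subst hee
    exact notMem_openGap_of_mem_cell_kid (ne_of_mem_sides he) hpc hp
  · exact (isEnd_of_mem_cell he he' hee (gaps_subset_cell e hg)
      (cell_kid_subset (ne_of_mem_sides he') i hpc)).notMem_openGap hp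

theorem isClosed_bump (e : Plane × Plane) : IsClosed (bump e) :=
  (Set.Finite.isCompact_convexHull ℝ (by simp)).isClosed

theorem isClosed_triangle : IsClosed triangle :=
  (Set.Finite.isCompact_convexHull ℝ (by simp)).isClosed

theorem isClosed_cell (e : Plane × Plane) : IsClosed (cell e) := by
  have h1 : IsClosed {p | 0 ≤ cy e p} := isClosed_le (by fun_prop) (by fun_prop)
  have h2 : IsClosed {p | cy e p ≤ cx e p} := isClosed_le (by fun_prop) (by fun_prop)
  have h3 : IsClosed {p | cx e p + 2 * cy e p ≤ 1} := isClosed_le (by fun_prop) (by fun_prop)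
  exact h1.inter (h2.inter h3)

theorem isClosed_gaps (e : Plane × Plane) : IsClosed (gaps e) := by
  have h {f g : Plane → ℝ} (hf : Continuous f) (hg : Continuous g) : IsClosed {p | f p ≤ g p} :=
    isClosed_le hf hg
  exact ((h (by fun_prop) (by fun_prop)).inter
    ((h (by fun_prop) (by fun_prop)).inter (h (by fun_prop) (by fun_prop)))).union
    ((h (by fun_prop) (by fun_prop)).inter
    ((h (by fun_prop) (by fun_prop)).inter (h (by fun_prop) (by fun_prop))))

theorem isClosed_biUnion_sides {k : ℕ} {f : Plane × Plane → Set Plane}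
    (hf : ∀ e, IsClosed (f e)) : IsClosed (⋃ e ∈ sides k, f e) :=
  (sides k).finite_toSet.isClosed_biUnion fun e _ => hf e

theorem isClosed_cells (k : ℕ) : IsClosed (cells k) := isClosed_biUnion_sides isClosed_cell

theorem isClosed_inner (k : ℕ) : IsClosed (inner k) := by
  induction k with
  | zero => exact isClosed_triangle
  | succ k ih => exact ih.union (isClosed_biUnion_sides isClosed_bump)

theorem isClosed_outer (k : ℕ) : IsClosed (outer k) := by
  induction k with
  | zero =>
    refine isClosed_biUnion_sides fun e => ?_
    have h1 : IsClosed {p | cx e p ≤ cy e p} := isClosed_le (by fun_prop) (by fun_prop)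
    have h2 : IsClosed {p | 1 ≤ cx e p + 2 * cy e p} := isClosed_le (by fun_prop) (by fun_prop)
    exact h1.union h2
  | succ k ih => exact ih.union (isClosed_biUnion_sides isClosed_gaps)

theorem frontier_snowflake_subset_cells (k : ℕ) : frontier snowflake ⊆ cells k := by
  intro p hp
  by_contra hpc
  rw [snowflake_eq, isOpen_interior.frontier_eq] at hp
  by_cases hi : p ∈ inner k
  -- the complement of `outer k ∪ cells k` is an open neighbourhood of `p` inside `inner k`
  · have ho : p ∉ outer k := fun ho => hpc (mem_cells_of_mem_inner_of_mem_outer hi ho)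
    refine hp.2 (mem_interior.2 ⟨(outer k ∪ cells k)ᶜ, ?_,
      ((isClosed_outer k).union (isClosed_cells k)).isOpen_compl, fun h => h.elim ho hpc⟩)
    intro q hq
    rcases inner_union_cells_union_outer k q with h | h | h
    · exact mem_closedFlake.2 ⟨k, h⟩
    · exact absurd (.inr h) hq
    · exact absurd (.inl h) hq
  -- the closed set `inner k ∪ cells k` contains the snowflake but not `p`
  · have hcl : closure (interior closedFlake) ⊆ inner k ∪ cells k :=
      closure_minimal (interior_subset.trans (closedFlake_subset k))
        ((isClosed_inner k).union (isClosed_cells k))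
    exact (hcl hp.1).elim hi hpc

/-! ### The boundary of the snowflake -/

theorem cell_subset_closedBall {e : Plane × Plane} (h : e.1 ≠ e.2) :
    cell e ⊆ Metric.closedBall e.1 (2 * ‖e.2 - e.1‖) := by
  intro p hp
  simp only [cell, mem_ofPred_eq] at hp
  rw [Metric.mem_closedBall]
  nth_rw 1 [← pt_coords h p, fst_eq_pt e]
  apply dist_pt_le <;> rw [abs_le] <;> constructor <;> linarith

theorem sides_nonempty (k : ℕ) : ∃ e, e ∈ sides k := by
  apply List.exists_mem_of_length_pos
  rw [length_sides]; positivity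

theorem frontier_snowflake_subset_snowflakeCurve : frontier snowflake ⊆ snowflakeCurve := by
  intro p hp
  have hle (k : ℕ) : Metric.infDist p (polygon k) ≤ 2 * (1 / 3) ^ k := by
    obtain ⟨e, he, h⟩ := mem_cells.1 (frontier_snowflake_subset_cells k hp)
    have h1 := cell_subset_closedBall (ne_of_mem_sides he) h
    rw [Metric.mem_closedBall, norm_of_mem_sides he] at h1
    refine (Metric.infDist_le_dist_of_mem ?_).trans h1
    exact mem_biUnion (x := e) he (left_mem_segment ℝ _ _)
  have hlim : Tendsto (fun k : ℕ => 2 * (1 / 3 : ℝ) ^ k) atTop (𝓝 0) := by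
    simpa using (tendsto_pow_atTop_nhds_zero_of_lt_one (r := (1 / 3 : ℝ)) (by norm_num)
      (by norm_num)).const_mul 2
  exact squeeze_zero (fun k => Metric.infDist_nonneg) hle hlim

/-- Arbitrarily small cells lie arbitrarily close to each point of the limit curve. -/
theorem exists_cell_subset_ball {p : Plane} (hp : p ∈ snowflakeCurve) {r : ℝ} (hr : 0 < r) :
    ∃ k, ∃ e ∈ sides k, cell e ⊆ Metric.ball p r := by
  have h1 : ∀ᶠ k in atTop, Metric.infDist p (polygon k) < r / 4 :=
    (tendsto_order.1 hp).2 _ (by positivity)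
  have h2 : ∀ᶠ k : ℕ in atTop, (1 / 3 : ℝ) ^ k < r / 4 :=
    (tendsto_order.1 (tendsto_pow_atTop_nhds_zero_of_lt_one (r := (1 / 3 : ℝ)) (by norm_num)
      (by norm_num))).2 _ (by positivity)
  obtain ⟨k, h1, h2⟩ := (h1.and h2).exists
  -- `Metric.infDist` to the empty set would be `0`
  have hne : (polygon k).Nonempty := by
    obtain ⟨e, he⟩ := sides_nonempty k
    exact ⟨e.1, mem_biUnion (x := e) he (left_mem_segment ℝ _ _)⟩
  obtain ⟨z, hz, hpz⟩ := (Metric.infDist_lt_iff hne).1 h1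
  obtain ⟨e, he, hze⟩ := mem_iUnion₂.1 hz
  refine ⟨k, e, he, fun q hq => ?_⟩
  have h3 := cell_subset_closedBall (ne_of_mem_sides he) hq
  have h4 : dist z e.1 ≤ ‖e.2 - e.1‖ := by
    rw [dist_eq_norm]
    exact norm_sub_le_of_mem_segment hze
  rw [norm_of_mem_sides he] at h4
  rw [Metric.mem_closedBall, norm_of_mem_sides he] at h3
  rw [Metric.mem_ball]
  have := dist_triangle4 q e.1 z p
  rw [dist_comm e.1 z, dist_comm z p] at this
  linarith

/-- The interior of `cell e`. -/
def openCell (e : Plane × Plane) : Set Plane :=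
  {p | 0 < cy e p ∧ cy e p < cx e p ∧ cx e p + 2 * cy e p < 1}

theorem openCell_subset_cell (e : Plane × Plane) : openCell e ⊆ cell e :=
  fun _ h => ⟨h.1.le, h.2.1.le, h.2.2.le⟩

theorem isOpen_openCell (e : Plane × Plane) : IsOpen (openCell e) := by
  have h1 : IsOpen {p | 0 < cy e p} := isOpen_lt (by fun_prop) (by fun_prop)
  have h2 : IsOpen {p | cy e p < cx e p} := isOpen_lt (by fun_prop) (by fun_prop)
  have h3 : IsOpen {p | cx e p + 2 * cy e p < 1} := isOpen_lt (by fun_prop) (by fun_prop)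
  exact h1.inter (h2.inter h3)

theorem openCell_kid_subset {e : Plane × Plane} (h : e.1 ≠ e.2) (i : Fin 4) :
    openCell (kid e i) ⊆ openCell e := by
  intro p hp
  have h4 := coords_kid h p
  simp only [openCell, mem_ofPred_eq] at hp ⊢
  fin_cases i <;> simp only [Fin.reduceFinMk, Fin.zero_eta, Fin.mk_one, h4] at hp <;> grind

theorem disjoint_openCell_kid {e : Plane × Plane} (h : e.1 ≠ e.2) {i j : Fin 4} (hij : i ≠ j) :
    Disjoint (openCell (kid e i)) (openCell (kid e j)) := by
  rw [Set.disjoint_left]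
  intro p hi hj
  exact hi.1.ne' (isEnd_of_mem_cell_kid h (openCell_subset_cell _ hi) (openCell_subset_cell _ hj)
    hij).cy_eq_zero

theorem abs_coords_sub_lt {e : Plane × Plane} (h : e.1 ≠ e.2) {a b : ℝ} {p : Plane}
    (hp : p ∈ Metric.ball (pt e a b) (‖e.2 - e.1‖ / 100)) :
    |cx e p - a| < 1 / 50 ∧ |cy e p - b| < 1 / 50 := by
  have hpos : 0 < ‖e.2 - e.1‖ := norm_pos_iff.2 (sub_ne_zero.2 h.symm)
  have h1 := abs_cx_sub_le h p (pt e a b)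
  have h2 := abs_cy_sub_le h p (pt e a b)
  rw [Metric.mem_ball, dist_eq_norm] at hp
  rw [cx_pt h] at h1
  rw [cy_pt h] at h2
  constructor <;> refine lt_of_mul_lt_mul_right ?_ hpos.le <;> linarith

/-- A disc about the centroid of the bump over `e`. -/
def bumpDisc (e : Plane × Plane) : Set Plane :=
  Metric.ball (pt e (4 / 9) (1 / 9)) (‖e.2 - e.1‖ / 100)

/-- A disc about the centroid of the first gap of `cell e`. -/
def gapDisc (e : Plane × Plane) : Set Plane :=
  Metric.ball (pt e (2 / 9) (1 / 9)) (‖e.2 - e.1‖ / 100)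

theorem bumpDisc_subset {e : Plane × Plane} (h : e.1 ≠ e.2) : bumpDisc e ⊆ bump e ∩ openCell e := by
  intro p hp
  obtain ⟨h1, h2⟩ := abs_coords_sub_lt h hp
  rw [abs_lt] at h1 h2
  refine ⟨(mem_bump h).2 ⟨?_, ?_, ?_⟩, ?_, ?_, ?_⟩ <;> linarith

theorem gapDisc_subset {e : Plane × Plane} (h : e.1 ≠ e.2) :
    gapDisc e ⊆ openGap e ∩ openCell e := by
  intro p hp
  obtain ⟨h1, h2⟩ := abs_coords_sub_lt h hp
  rw [abs_lt] at h1 h2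
  refine ⟨⟨?_, ?_, ?_⟩, ?_, ?_, ?_⟩ <;> linarith

theorem bumpDisc_subset_snowflake {k : ℕ} {e : Plane × Plane} (he : e ∈ sides k) :
    bumpDisc e ⊆ snowflake :=
  interior_maximal (((bumpDisc_subset (ne_of_mem_sides he)).trans inter_subset_left).trans
    (bump_subset_closedFlake he)) Metric.isOpen_ball

theorem gapDisc_subset_compl {k : ℕ} {e : Plane × Plane} (he : e ∈ sides k) :
    gapDisc e ⊆ snowflakeᶜ := fun _ hp hS =>
  Set.disjoint_left.1 (disjoint_openGap_closedFlake he) (gapDisc_subset (ne_of_mem_sides he) hp).1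
    (interior_subset hS)

theorem bumpDisc_pos {e : Plane × Plane} (h : e.1 ≠ e.2) : 0 < volume (bumpDisc e) :=
  Metric.measure_ball_pos _ _ (div_pos (norm_pos_iff.2 (sub_ne_zero.2 h.symm)) (by norm_num))

theorem gapDisc_pos {e : Plane × Plane} (h : e.1 ≠ e.2) : 0 < volume (gapDisc e) :=
  Metric.measure_ball_pos _ _ (div_pos (norm_pos_iff.2 (sub_ne_zero.2 h.symm)) (by norm_num))

theorem snowflakeCurve_subset_essBoundary : snowflakeCurve ⊆ essBoundary snowflake := by
  intro p hp r hr
  obtain ⟨k, e, he, hcell⟩ := exists_cell_subset_ball hp hr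
  have h := ne_of_mem_sides he
  have hb : bumpDisc e ⊆ snowflake ∩ Metric.ball p r := fun q hq =>
    ⟨bumpDisc_subset_snowflake he hq,
      hcell (openCell_subset_cell e (bumpDisc_subset h hq).2)⟩
  have hg : gapDisc e ⊆ Metric.ball p r \ (snowflake ∩ Metric.ball p r) := fun q hq =>
    ⟨hcell (openCell_subset_cell e (gapDisc_subset h hq).2),
      fun hqs => gapDisc_subset_compl he hq hqs.1⟩
  refine ⟨(bumpDisc_pos h).trans_le (measure_mono hb), ?_⟩
  have hm : MeasurableSet (snowflake ∩ Metric.ball p r) :=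
    (isOpen_interior.inter Metric.isOpen_ball).measurableSet
  rw [← measure_sdiff_add_inter (Metric.ball p r) hm, inter_eq_right.2 inter_subset_right, add_comm]
  refine ENNReal.lt_add_right ?_ ((gapDisc_pos h).trans_le (measure_mono hg)).ne'
  exact ((measure_mono inter_subset_right).trans_lt measure_ball_lt_top).ne

theorem essBoundary_subset_frontier {n : ℕ} (E : Set (EuclideanSpace ℝ (Fin n))) :
    essBoundary E ⊆ frontier E := by
  intro p hp
  refine ⟨Metric.mem_closure_iff.2 fun r hr => ?_, fun hi => ?_⟩
  · obtain ⟨q, hq⟩ := nonempty_of_measure_ne_zero (hp r hr).1.ne'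
    exact ⟨q, hq.1, by simpa [dist_comm] using hq.2⟩
  · obtain ⟨r, hr, hball⟩ := Metric.mem_nhds_iff.1 (mem_interior_iff_mem_nhds.1 hi)
    have := (hp r hr).2
    rw [inter_eq_right.2 hball] at this
    exact this.false

theorem frontier_snowflake_eq : frontier snowflake = snowflakeCurve :=
  frontier_snowflake_subset_snowflakeCurve.antisymm
    (snowflakeCurve_subset_essBoundary.trans (essBoundary_subset_frontier _))

theorem essBoundary_snowflake_eq : essBoundary snowflake = frontier snowflake :=
  (essBoundary_subset_frontier _).antisymm
    (frontier_snowflake_subset_snowflakeCurve.trans snowflakeCurve_subset_essBoundary)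

/-! ### Divergence of the fractional perimeter -/

theorem localPerimeter_mono {n : ℕ} (s : ℝ) (E : Set (EuclideanSpace ℝ (Fin n)))
    {Ω Ω' : Set (EuclideanSpace ℝ (Fin n))} (h : Ω ⊆ Ω') :
    localPerimeter s E Ω ≤ localPerimeter s E Ω' :=
  (lintegral_mono_set (inter_subset_inter_right E h)).trans
    (lintegral_mono fun _ => lintegral_mono_set (inter_subset_inter_right Eᶜ h))

/-- The local perimeter is superadditive over disjoint open sets. -/
theorem sum_localPerimeter_le {n : ℕ} {ι : Type*} [Fintype ι] (s : ℝ)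
    {E Ω : Set (EuclideanSpace ℝ (Fin n))} (hE : MeasurableSet E)
    {U : ι → Set (EuclideanSpace ℝ (Fin n))} (hU : ∀ i, IsOpen (U i)) (hsub : ∀ i, U i ⊆ Ω)
    (hd : Pairwise fun i j => Disjoint (U i) (U j)) :
    ∑ i, localPerimeter s E (U i) ≤ localPerimeter s E Ω := by
  have hd' : (↑(Finset.univ : Finset ι) : Set ι).PairwiseDisjoint fun i => E ∩ U i :=
    fun i _ j _ hij => (hd hij).mono inter_subset_right inter_subset_right
  calc ∑ i, localPerimeter s E (U i)
      ≤ ∑ i, ∫⁻ x in E ∩ U i, ∫⁻ y in Eᶜ ∩ Ω, ENNReal.ofReal (1 / ‖x - y‖ ^ ((n : ℝ) + s)) :=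
        Finset.sum_le_sum fun i _ => lintegral_mono fun _ =>
          lintegral_mono_set (inter_subset_inter_right Eᶜ (hsub i))
    _ = ∫⁻ x in ⋃ i ∈ Finset.univ, E ∩ U i, ∫⁻ y in Eᶜ ∩ Ω,
          ENNReal.ofReal (1 / ‖x - y‖ ^ ((n : ℝ) + s)) :=
        (lintegral_biUnion_finset hd' (fun i _ => hE.inter (hU i).measurableSet) _).symm
    _ ≤ localPerimeter s E Ω :=
        lintegral_mono_set (iUnion₂_subset fun i _ => inter_subset_inter_right E (hsub i))

theorem measurableSet_snowflake : MeasurableSet snowflake := isOpen_interior.measurableSet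

theorem volume_ball_plane (x : Plane) {r : ℝ} (hr : 0 ≤ r) :
    volume (Metric.ball x r) = ENNReal.ofReal (r ^ 2) * volume (Metric.ball (0 : Plane) 1) := by
  rw [Measure.addHaar_ball _ _ hr, finrank_euclideanSpace_fin]

/-- The constant in the lower bound for the interaction of two opposite discs. -/
def discConst (s : ℝ) : ℝ≥0∞ :=
  ENNReal.ofReal (1 / 2 ^ (2 + s) / 100 ^ 4) * volume (Metric.ball (0 : Plane) 1) ^ 2

theorem discConst_ne_zero (s : ℝ) : discConst s ≠ 0 := by
  have := Metric.measure_ball_pos volume (0 : Plane) one_pos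
  refine mul_ne_zero (ENNReal.ofReal_pos.2 (by positivity)).ne' (pow_ne_zero 2 this.ne')

/-- The bump and a gap of a single cell contribute an amount that scales with the power `2 - s` of
the length of the side. -/
theorem discConst_le_localPerimeter {s : ℝ} (hs : 0 < s) {k : ℕ} {e : Plane × Plane}
    (he : e ∈ sides k) :
    discConst s * ENNReal.ofReal ((3 ^ (s - 2)) ^ k) ≤ localPerimeter s snowflake (openCell e) := by
  have h := ne_of_mem_sides he
  have hb : bumpDisc e ⊆ snowflake ∩ openCell e := fun q hq =>
    ⟨bumpDisc_subset_snowflake he hq, (bumpDisc_subset h hq).2⟩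
  have hg : gapDisc e ⊆ snowflakeᶜ ∩ openCell e := fun q hq =>
    ⟨gapDisc_subset_compl he hq, (gapDisc_subset h hq).2⟩
  have hlen := norm_of_mem_sides he
  set l : ℝ := (1 / 3) ^ k with hl
  have hl0 : 0 < l := by positivity
  set v := volume (Metric.ball (0 : Plane) 1) with hv
  have hK {x y : Plane} (hx : x ∈ bumpDisc e) (hy : y ∈ gapDisc e) :
      ENNReal.ofReal (1 / (2 * l) ^ (2 + s)) ≤
        ENNReal.ofReal (1 / ‖x - y‖ ^ (((2 : ℕ) : ℝ) + s)) := by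
    have hxy : 0 < ‖x - y‖ := by
      rw [norm_pos_iff, sub_ne_zero]
      rintro rfl
      exact (hg hy).1 (hb hx).1
    have hle : ‖x - y‖ ≤ 2 * l := by
      have hx' := openCell_subset_cell e (hb hx).2
      have hy' := openCell_subset_cell e (hg hy).2
      simp only [cell, mem_ofPred_eq] at hx' hy'
      rw [← dist_eq_norm, ← pt_coords h x, ← pt_coords h y, ← hlen]
      apply dist_pt_le <;> rw [abs_le] <;> constructor <;> linarith
    push_cast
    gcongr
  have hvol {a b : ℝ} : volume (Metric.ball (pt e a b) (‖e.2 - e.1‖ / 100)) =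
      ENNReal.ofReal ((l / 100) ^ 2) * v := by
    rw [hlen, volume_ball_plane _ (by positivity)]
  calc discConst s * ENNReal.ofReal ((3 ^ (s - 2)) ^ k)
      = ENNReal.ofReal (1 / (2 * l) ^ (2 + s)) * volume (gapDisc e) * volume (bumpDisc e) := by
        rw [gapDisc, bumpDisc, hvol, hvol, discConst, ← hv]
        have : (1 / 2 ^ (2 + s) / 100 ^ 4) * ((3 : ℝ) ^ (s - 2)) ^ k =
            1 / (2 * l) ^ (2 + s) * (l / 100) ^ 2 * (l / 100) ^ 2 := by
          have h3 : ((3 : ℝ) ^ (s - 2)) ^ k = l ^ (2 - s) := by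
            rw [hl, one_div, inv_pow, Real.inv_rpow (by positivity), ← Real.rpow_neg (by positivity),
              neg_sub, ← Real.rpow_natCast, ← Real.rpow_mul (by norm_num), ← Real.rpow_natCast,
              ← Real.rpow_mul (by norm_num), mul_comm]
          have h4 : l ^ (2 - s) * l ^ (2 + s) = l ^ 4 := by
            rw [← Real.rpow_add hl0, ← Real.rpow_natCast]; norm_num
          rw [h3, Real.mul_rpow (by norm_num) hl0.le]
          have : 0 < l ^ (2 + s) := by positivity
          have : (0 : ℝ) < 2 ^ (2 + s) := by positivity
          field_simp
          linear_combination h4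
        rw [mul_right_comm, ← ENNReal.ofReal_mul (by positivity), this,
          ENNReal.ofReal_mul (by positivity), ENNReal.ofReal_mul (by positivity)]
        ring
    _ = ∫⁻ _ in bumpDisc e, ∫⁻ _ in gapDisc e, ENNReal.ofReal (1 / (2 * l) ^ (2 + s)) := by
        simp
    _ ≤ ∫⁻ x in bumpDisc e, ∫⁻ y in gapDisc e,
          ENNReal.ofReal (1 / ‖x - y‖ ^ (((2 : ℕ) : ℝ) + s)) :=
        setLIntegral_mono' measurableSet_ball fun x hx =>
          setLIntegral_mono' measurableSet_ball fun y hy => hK hx hy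
    _ ≤ localPerimeter s snowflake (openCell e) :=
        (lintegral_mono_set hb).trans (lintegral_mono fun _ => lintegral_mono_set hg)

/-- Passing `m` generations down multiplies the number of cells by `4 ^ m` and the contribution of
each by `3 ^ ((s - 2) * m)`. -/
theorem pow_mul_discConst_le_localPerimeter {s : ℝ} (hs : 0 < s) (m : ℕ) :
    ∀ {k : ℕ} {e : Plane × Plane}, e ∈ sides k →
      4 ^ m * (discConst s * ENNReal.ofReal ((3 ^ (s - 2)) ^ (k + m))) ≤
        localPerimeter s snowflake (openCell e) := by
  induction m with
  | zero => intro k e he; simpa using discConst_le_localPerimeter hs he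
  | succ m ih =>
    intro k e he
    have h := ne_of_mem_sides he
    have hkid (i : Fin 4) := ih (mem_sides_succ.2 ⟨e, he, i, rfl⟩)
    calc _ = ∑ _i : Fin 4, 4 ^ m * (discConst s * ENNReal.ofReal ((3 ^ (s - 2)) ^ (k + 1 + m))) := by
            rw [Finset.sum_const, Finset.card_univ, Fintype.card_fin, nsmul_eq_mul,
              show k + (m + 1) = k + 1 + m by ring]
            push_cast; ring
      _ ≤ ∑ i, localPerimeter s snowflake (openCell (kid e i)) :=
          Finset.sum_le_sum fun i _ => hkid i
      _ ≤ _ := sum_localPerimeter_le s measurableSet_snowflake (fun i => isOpen_openCell _)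
          (openCell_kid_subset h) fun i j hij => disjoint_openCell_kid h hij

theorem localPerimeter_snowflake_openCell {s : ℝ} (hs : 0 < s) (hs' : 1 < 4 * (3 : ℝ) ^ (s - 2))
    {k : ℕ} {e : Plane × Plane} (he : e ∈ sides k) :
    localPerimeter s snowflake (openCell e) = ∞ := by
  set q : ℝ := 3 ^ (s - 2) with hq
  have hq0 : 0 < q := by positivity
  have hle (m : ℕ) : discConst s * ENNReal.ofReal (q ^ k) * ENNReal.ofReal (4 * q) ^ m ≤
      localPerimeter s snowflake (openCell e) := by
    refine le_trans (le_of_eq ?_) (pow_mul_discConst_le_localPerimeter hs m he)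
    rw [pow_add, ENNReal.ofReal_mul (by positivity), ENNReal.ofReal_mul (by positivity),
      ENNReal.ofReal_pow hq0.le, ENNReal.ofReal_pow hq0.le, mul_pow]
    norm_num
    ring
  have hlim := ENNReal.Tendsto.const_mul
    (ENNReal.tendsto_pow_atTop_nhds_top_iff.2 (ENNReal.one_lt_ofReal.2 hs'))
    (a := discConst s * ENNReal.ofReal (q ^ k)) (.inl ENNReal.top_ne_zero)
  rw [ENNReal.mul_top (mul_ne_zero (discConst_ne_zero s)
    (ENNReal.ofReal_pos.2 (by positivity)).ne')] at hlim
  exact top_le_iff.1 (le_of_tendsto' hlim hle)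

theorem localPerimeter_snowflake_eq_top {s : ℝ} (hs : 0 < s) (hs' : 1 < 4 * (3 : ℝ) ^ (s - 2))
    {Ω : Set Plane} (hΩ : IsOpen Ω) (hne : (frontier snowflake ∩ Ω).Nonempty) :
    localPerimeter s snowflake Ω = ∞ := by
  obtain ⟨p, hp, hpΩ⟩ := hne
  obtain ⟨r, hr, hball⟩ := Metric.isOpen_iff.1 hΩ p hpΩ
  obtain ⟨k, e, he, hcell⟩ :=
    exists_cell_subset_ball (frontier_snowflake_subset_snowflakeCurve hp) hr
  refine top_le_iff.1 ((localPerimeter_snowflake_openCell hs hs' he).symm.le.trans ?_)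
  exact localPerimeter_mono s _ ((openCell_subset_cell e).trans (hcell.trans hball))

/-! ### Convergence of the fractional perimeter and the dimension -/

theorem exists_mem_segment_frontier {E : Set Plane} {x y : Plane} (hx : x ∈ E) (hy : y ∉ E) :
    ∃ z ∈ segment ℝ x y, z ∈ frontier E := by
  by_contra! hn
  have hpre : IsPreconnected (segment ℝ x y) := (convex_segment x y).isPreconnected
  have hcov : segment ℝ x y ⊆ interior E ∪ (closure E)ᶜ := by
    intro z hz
    by_cases hi : z ∈ interior E
    · exact .inl hi
    · exact .inr fun hc => hn z hz ⟨hc, hi⟩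
  have hdisj : Disjoint (interior E) (closure E)ᶜ :=
    disjoint_compl_right.mono_left (interior_subset.trans subset_closure)
  rcases hpre.subset_or_subset isOpen_interior isClosed_closure.isOpen_compl hdisj hcov with h | h
  · exact hy (interior_subset (h (right_mem_segment ℝ x y)))
  · exact h (left_mem_segment ℝ x y) (subset_closure hx)

/-- A union of `3 * 4 ^ k` discs which contains the `3⁻ᵏ`-neighbourhood of the boundary of the
snowflake. -/
def collar (k : ℕ) : Set Plane := ⋃ e ∈ sides k, Metric.closedBall e.1 (3 * (1 / 3) ^ k)

theorem measurableSet_collar (k : ℕ) : MeasurableSet (collar k) :=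
  (isClosed_biUnion_sides fun _ => Metric.isClosed_closedBall).measurableSet

theorem mem_collar {x y : Plane} (hx : x ∈ snowflake) (hy : y ∉ snowflake) {k : ℕ}
    (hxy : ‖x - y‖ ≤ (1 / 3) ^ k) : x ∈ collar k := by
  obtain ⟨z, hz, hzf⟩ := exists_mem_segment_frontier hx hy
  obtain ⟨e, he, hze⟩ := mem_cells.1 (frontier_snowflake_subset_cells k hzf)
  refine mem_biUnion (x := e) he ?_
  have h1 := cell_subset_closedBall (ne_of_mem_sides he) hze
  rw [Metric.mem_closedBall, norm_of_mem_sides he] at h1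
  have h2 : dist z x ≤ ‖x - y‖ := by
    rw [dist_eq_norm, norm_sub_rev x y]
    exact norm_sub_le_of_mem_segment hz
  rw [Metric.mem_closedBall]
  have := dist_triangle x z e.1
  rw [dist_comm x z] at this
  linarith

theorem measure_biUnion_list_le {α β : Type*} [MeasurableSpace α] (μ : Measure α) {f : β → Set α}
    {c : ℝ≥0∞} (l : List β) (h : ∀ b ∈ l, μ (f b) ≤ c) : μ (⋃ b ∈ l, f b) ≤ l.length * c := by
  induction l with
  | nil => simp
  | cons a l ih =>
    have : (⋃ b ∈ a :: l, f b) = f a ∪ ⋃ b ∈ l, f b := by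
      simp [iUnion_or, iUnion_union_distrib]
    rw [this, List.length_cons]
    push_cast
    rw [add_mul, one_mul, add_comm]
    exact (measure_union_le _ _).trans (add_le_add (h a (by simp))
      (ih fun b hb => h b (by simp [hb])))

theorem volume_closedBall_plane (x : Plane) {r : ℝ} (hr : 0 ≤ r) :
    volume (Metric.closedBall x r) =
      ENNReal.ofReal (r ^ 2) * volume (Metric.ball (0 : Plane) 1) := by
  rw [Measure.addHaar_closedBall _ _ hr, finrank_euclideanSpace_fin]

theorem volume_collar_le (k : ℕ) : volume (collar k) ≤
    ENNReal.ofReal (27 * (4 / 9) ^ k) * volume (Metric.ball (0 : Plane) 1) := by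
  refine (measure_biUnion_list_le volume (sides k) fun e _ =>
    (volume_closedBall_plane e.1 (by positivity)).le).trans (le_of_eq ?_)
  rw [length_sides, ← mul_assoc, ← ENNReal.ofReal_natCast, ← ENNReal.ofReal_mul (by positivity)]
  congr 2
  push_cast
  rw [mul_pow, ← pow_mul, mul_comm k 2, pow_mul, show (4 / 9 : ℝ) = 4 * (1 / 3) ^ 2 by norm_num,
    mul_pow]
  ring

theorem volume_snowflake_lt_top : volume snowflake < ∞ := by
  have hb : Bornology.IsBounded (inner 0 ∪ cells 0) := by
    refine Bornology.IsBounded.union ?_ ?_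
    · exact (Set.Finite.isCompact_convexHull ℝ (by simp)).isBounded
    · exact (Bornology.isBounded_biUnion (sides 0).finite_toSet).2 fun e he =>
        Metric.isBounded_closedBall.subset (cell_subset_closedBall (ne_of_mem_sides he))
  exact (hb.subset (interior_subset.trans (closedFlake_subset 0))).measure_lt_top

/-- An upper bound for the kernel on the annulus with radii `3⁻⁽ᵏ⁺¹⁾` and `3⁻ᵏ`. -/
def annulusBound (s : ℝ) (k : ℕ) : ℝ≥0∞ := ENNReal.ofReal (1 / ((1 / 3) ^ (k + 1)) ^ (2 + s))

/-- An integrable bound for the kernel away from the diagonal. -/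
def farKernel (s : ℝ) (z : Plane) : ℝ≥0∞ :=
  ENNReal.ofReal (2 ^ (2 + s)) * ENNReal.ofReal ((1 + ‖z‖) ^ (-(2 + s)))

theorem lintegral_farKernel_lt_top {s : ℝ} (hs : 0 < s) : ∫⁻ z, farKernel s z < ∞ := by
  unfold farKernel
  rw [lintegral_const_mul' _ _ ENNReal.ofReal_ne_top]
  refine ENNReal.mul_lt_top ENNReal.ofReal_lt_top (finite_integral_one_add_norm ?_)
  rw [finrank_euclideanSpace_fin]
  push_cast; linarith

/-- Across the boundary, points at distance at most `3⁻ᵏ` lie in the `k`-th collar. -/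
theorem kernel_le {s : ℝ} (hs : 0 < s) {x y : Plane} (hx : x ∈ snowflake) (hy : y ∉ snowflake) :
    ENNReal.ofReal (1 / ‖x - y‖ ^ (((2 : ℕ) : ℝ) + s)) ≤ farKernel s (x - y) +
      ∑' k, (collar k).indicator 1 x *
        (Metric.closedBall x ((1 / 3) ^ k)).indicator (fun _ => annulusBound s k) y := by
  have hpos : 0 < ‖x - y‖ := by
    rw [norm_pos_iff, sub_ne_zero]
    rintro rfl
    exact hy hx
  push_cast
  rcases le_total ‖x - y‖ 1 with h1 | h1
  · obtain ⟨k, hk, hk'⟩ := exists_nat_pow_near_of_lt_one hpos h1 (y := (1 / 3 : ℝ))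
      (by norm_num) (by norm_num)
    refine le_trans ?_ (le_add_left (ENNReal.le_tsum k))
    rw [indicator_of_mem (mem_collar hx hy hk'), indicator_of_mem, Pi.one_apply, one_mul,
      annulusBound]
    · gcongr
    · rwa [Metric.mem_closedBall, dist_comm, dist_eq_norm]
  -- far from the diagonal, `1 + r ≤ 2 * r`
  · refine le_trans ?_ le_self_add
    rw [farKernel, ← ENNReal.ofReal_mul (by positivity), Real.rpow_neg (by positivity),
      ← div_eq_mul_inv, ← Real.div_rpow (by norm_num) (by positivity), ← inv_eq_one_div,
      ← Real.inv_rpow hpos.le]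
    gcongr
    rw [inv_eq_one_div, div_le_div_iff₀ hpos (by positivity)]
    linarith

theorem localPerimeter_snowflake_lt_top {s : ℝ} (hs : 0 < s) (hs' : 4 * (3 : ℝ) ^ (s - 2) < 1)
    (Ω : Set Plane) : localPerimeter s snowflake Ω < ∞ := by
  set v := volume (Metric.ball (0 : Plane) 1) with hv
  have hvt : v < ∞ := measure_ball_lt_top
  set F := ∫⁻ z, farKernel s z with hF
  have hm := measurableSet_snowflake
  have hfar : Measurable (farKernel s) := by unfold farKernel; fun_prop
  have hin (x : Plane) (hx : x ∈ snowflake) :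
      ∫⁻ y in snowflakeᶜ, ENNReal.ofReal (1 / ‖x - y‖ ^ (((2 : ℕ) : ℝ) + s)) ≤
        F + ∑' k, (collar k).indicator (fun _ => annulusBound s k *
          (ENNReal.ofReal (((1 / 3) ^ k) ^ 2) * v)) x := by
    calc _ ≤ ∫⁻ y in snowflakeᶜ, (farKernel s (x - y) + ∑' k, (collar k).indicator 1 x *
              (Metric.closedBall x ((1 / 3) ^ k)).indicator (fun _ => annulusBound s k) y) :=
          setLIntegral_mono' hm.compl fun y hy => kernel_le hs hx hy
      _ ≤ ∫⁻ y, (farKernel s (x - y) + ∑' k, (collar k).indicator 1 x *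
              (Metric.closedBall x ((1 / 3) ^ k)).indicator (fun _ => annulusBound s k) y) :=
          setLIntegral_le_lintegral _ _
      _ = F + ∑' k, (collar k).indicator (fun _ => annulusBound s k *
          (ENNReal.ofReal (((1 / 3) ^ k) ^ 2) * v)) x := by
          rw [lintegral_add_left (by fun_prop), lintegral_sub_left_eq_self, lintegral_tsum]
          · congr 2
            ext k
            rw [lintegral_const_mul _ (measurable_const.indicator measurableSet_closedBall),
              lintegral_indicator_const measurableSet_closedBall,
              volume_closedBall_plane _ (by positivity)]
            by_cases hk : x ∈ collar k <;> simp [hk, hv]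
          · exact fun k => ((measurable_const.indicator
              measurableSet_closedBall).const_mul _).aemeasurable
  have hsum : ∑' k, annulusBound s k * (ENNReal.ofReal (((1 / 3) ^ k) ^ 2) * v) *
      volume (collar k) < ∞ := by
    calc _ ≤ ∑' k, v ^ 2 * ENNReal.ofReal (27 * 3 ^ (2 + s) * (4 * 3 ^ (s - 2)) ^ k) := by
          refine ENNReal.tsum_le_tsum fun k => ?_
          refine (mul_le_mul_right (volume_collar_le k) _).trans (le_of_eq ?_)
          rw [← hv, annulusBound]
          have : 27 * (3 : ℝ) ^ (2 + s) * (4 * 3 ^ (s - 2)) ^ k =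
              1 / ((1 / 3) ^ (k + 1)) ^ (2 + s) * ((1 / 3) ^ k) ^ 2 * (27 * (4 / 9) ^ k) := by
            have e1 : 1 / (((1 : ℝ) / 3) ^ (k + 1)) ^ (2 + s) =
                3 ^ (2 + s) * ((3 : ℝ) ^ (2 + s)) ^ k := by
              rw [one_div, one_div, inv_pow, Real.inv_rpow (by positivity), inv_inv,
                ← Real.rpow_natCast, ← Real.rpow_mul (by norm_num), mul_comm _ (2 + s),
                Real.rpow_mul (by norm_num), Real.rpow_natCast, pow_succ]
              ring
            have e2 : (3 : ℝ) ^ (2 + s) = 3 ^ (s - 2) * 81 := by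
              rw [show 2 + s = (s - 2) + (4 : ℕ) by push_cast; ring,
                Real.rpow_add_natCast (by norm_num)]
              norm_num
            have e3 : (4 * (3 : ℝ) ^ (s - 2)) ^ k =
                (3 ^ (2 + s)) ^ k * ((1 / 3) ^ k) ^ 2 * (4 / 9) ^ k := by
              rw [e2, ← pow_mul, mul_comm k 2, pow_mul, ← mul_pow, ← mul_pow]
              congr 1; ring
            rw [e1, e3]; ring
          rw [this, ENNReal.ofReal_mul (q := 27 * (4 / 9) ^ k) (by positivity),
            ENNReal.ofReal_mul (q := ((1 / 3) ^ k) ^ 2) (by positivity)]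
          ring
      _ < ∞ := by
          rw [ENNReal.tsum_mul_left]
          refine ENNReal.mul_lt_top (ENNReal.pow_lt_top hvt) (Summable.tsum_ofReal_lt_top ?_)
          exact (summable_geometric_of_lt_one (by positivity) hs').mul_left _
  calc localPerimeter s snowflake Ω
      ≤ ∫⁻ x in snowflake, ∫⁻ y in snowflakeᶜ,
          ENNReal.ofReal (1 / ‖x - y‖ ^ (((2 : ℕ) : ℝ) + s)) :=
        (lintegral_mono_set inter_subset_left).trans
          (lintegral_mono fun _ => lintegral_mono_set inter_subset_left)
    _ ≤ ∫⁻ x in snowflake, (F + ∑' k, (collar k).indicator (fun _ => annulusBound s k *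
          (ENNReal.ofReal (((1 / 3) ^ k) ^ 2) * v)) x) := setLIntegral_mono' hm hin
    _ = F * volume snowflake + ∫⁻ x in snowflake, ∑' k, (collar k).indicator (fun _ =>
          annulusBound s k * (ENNReal.ofReal (((1 / 3) ^ k) ^ 2) * v)) x := by
        rw [lintegral_add_left measurable_const, setLIntegral_const]
    _ ≤ F * volume snowflake + ∫⁻ x, ∑' k, (collar k).indicator (fun _ =>
          annulusBound s k * (ENNReal.ofReal (((1 / 3) ^ k) ^ 2) * v)) x := by
        gcongr; exact Measure.restrict_le_self
    _ = F * volume snowflake + ∑' k, annulusBound s k *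
          (ENNReal.ofReal (((1 / 3) ^ k) ^ 2) * v) * volume (collar k) := by
        rw [lintegral_tsum fun k =>
          (measurable_const.indicator (measurableSet_collar k)).aemeasurable]
        simp only [lintegral_indicator_const (measurableSet_collar _)]
    _ < ∞ := ENNReal.add_lt_top.2 ⟨ENNReal.mul_lt_top (lintegral_farKernel_lt_top hs)
        volume_snowflake_lt_top, hsum⟩

theorem log_four_mul_rpow (s : ℝ) :
    Real.log (4 * (3 : ℝ) ^ (s - 2)) = Real.log 3 * (s - (2 - Real.log 4 / Real.log 3)) := by
  have h3 : 0 < Real.log 3 := Real.log_pos (by norm_num)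
  rw [Real.log_mul (by norm_num) (by positivity), Real.log_rpow (by norm_num)]
  field_simp
  ring

theorem dimF_snowflake {Ω : Set Plane} (hΩ : IsOpen Ω) (hne : (frontier snowflake ∩ Ω).Nonempty) :
    dimF snowflake Ω = Real.log 4 / Real.log 3 := by
  set σ := 2 - Real.log 4 / Real.log 3 with hσ
  have h3 : 0 < Real.log 3 := Real.log_pos (by norm_num)
  have hσ0 : 0 < σ := by
    rw [hσ, sub_pos, div_lt_iff₀ h3, show (2 : ℝ) * Real.log 3 = Real.log (3 ^ 2) by simp]
    exact Real.log_lt_log (by norm_num) (by norm_num)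
  have hσ1 : σ < 1 := by
    have : 1 < Real.log 4 / Real.log 3 := by
      rw [one_lt_div h3]
      exact Real.log_lt_log (by norm_num) (by norm_num)
    linarith
  have hfin {s : ℝ} (hs : 0 < s) (hsσ : s < σ) : localPerimeter s snowflake Ω < ∞ := by
    refine localPerimeter_snowflake_lt_top hs ?_ Ω
    rw [← Real.log_neg_iff (by positivity), log_four_mul_rpow]
    exact mul_neg_of_pos_of_neg h3 (by linarith)
  have hsup : sSup {s : ℝ | s ∈ Ioo (0 : ℝ) 1 ∧ localPerimeter s snowflake Ω < ∞} = σ := by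
    refine csSup_eq_of_forall_le_of_forall_lt_exists_gt
      ⟨σ / 2, ⟨by linarith, by linarith⟩, hfin (by linarith) (by linarith)⟩ ?_ ?_
    · rintro s ⟨⟨hs0, -⟩, hs⟩
      by_contra! hlt
      refine hs.ne (localPerimeter_snowflake_eq_top hs0 ?_ hΩ hne)
      rw [← Real.log_pos_iff (by positivity), log_four_mul_rpow]
      exact mul_pos h3 (by linarith)
    · intro w hw
      have hw' : max w 0 < σ := max_lt hw hσ0
      obtain ⟨s, hs1, hs2⟩ := exists_between hw'
      have hs0 : 0 < s := (le_max_right w 0).trans_lt hs1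
      exact ⟨s, ⟨⟨hs0, hs2.trans hσ1⟩, hfin hs0 hs2⟩, (le_max_left w 0).trans_lt hs1⟩
  rw [dimF, hsup, hσ]
  push_cast; ring

end

end FractalDim

theorem mainTheorem5 :
    (FractalDim.essBoundary FractalDim.snowflake = frontier FractalDim.snowflake ∧
      frontier FractalDim.snowflake = FractalDim.snowflakeCurve) ∧
    (∀ Ω : Set (EuclideanSpace ℝ (Fin 2)), IsOpen Ω →
      (frontier FractalDim.snowflake ∩ Ω).Nonempty →
      FractalDim.dimF FractalDim.snowflake Ω = Real.log 4 / Real.log 3) ∧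
    (∀ p ∈ frontier FractalDim.snowflake, ∀ r : ℝ, 0 < r →
      FractalDim.dimF FractalDim.snowflake (Metric.ball p r) = Real.log 4 / Real.log 3) := by
  have hΩ (Ω : Set (EuclideanSpace ℝ (Fin 2))) (h : IsOpen Ω)
      (hne : (frontier FractalDim.snowflake ∩ Ω).Nonempty) :
      FractalDim.dimF FractalDim.snowflake Ω = Real.log 4 / Real.log 3 :=
    FractalDim.dimF_snowflake h hne
  exact ⟨⟨FractalDim.essBoundary_snowflake_eq, FractalDim.frontier_snowflake_eq⟩, hΩ,
    fun p hp r hr => hΩ _ Metric.isOpen_ball ⟨p, hp, Metric.mem_ball_self hr⟩⟩
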